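/- Let $V$ be a countable set of sites and $N\in\mathbb{N}$. An open quantum walk (OQW) $\Phi$ on $V$ with internal degree of freedom $\mathbb{C}^N$ is given by matrices $B_i^j\in M_N(\mathbb{C})$ $(i,j\in V)$ with $\sum_{j\in V} B_i^{j*}B_i^j=I$ for every $i\in V$; it acts by $\Phi(\cdot)=\sum_{i,j}M_i^j\,\cdot\,M_i^{j*}$ with $M_i^j=B_i^j\otimes|j\rangle\langle i|$ on $\mathbb{C}^N\otimes\ell^2(V)$. It is irreducible if the only closed subspaces of $\mathbb{C}^N\otimes\ell^2(V)$ invariant under all the operators $M_i^j$ are $\{0\}$ and the whole space. A density is a positive semidefinite $\rho\in M_N(\mathbb{C})$ with $\mathrm{Tr}(\rho)=1$; put $p_\rho(i\stackrel{1}{\to}j)=\mathrm{Tr}(B_i^j\rho B_i^{j*})$. The quantum trajectory $(\rho_n,X_n)_{n\ge 0}$ is the homogeneous Markov chain which, from $(\rho,i)$, moves with probability $p_\rho(i\stackrel{1}{\to}j)$ to $\big(B_i^j\rho B_i^{j*}/\mathrm{Tr}(B_i^j\rho B_i^{j*}),\,j\big)$; $E_{i,\rho}$ is the expectation for the chain started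 at $(\rho,i)$. For $F\subseteq V$ let $\tau_F=\inf\{n\ge 1: X_n\in F\}\in\mathbb{N}\cup\{\infty\}$ be the return time to $F$, and write $T_i=\tau_{\{i\}}$. **Theorem (Foster's Theorem for OQWs).** Let $\Phi$ be an irreducible OQW on $V$. Assume there are a function $h:V\to\mathbb{R}$, a finite set $F\subseteq V$ and $\epsilon>0$ such that 1. $\inf_{i\in V} h(i)>-\infty$, 2. $\sum_{k\in V}p_\rho(i\stackrel{1}{\to}k)\,h(k)<\infty$ for every density $\rho$ and every $i\in F$, 3. $\sum_{k\in V}p_\rho(i\stackrel{1}{\to}k)\,h(k)\le h(i)-\epsilon$ for every density $\rho$ and every $i\notin F$. Then $E_{i,\rho}[\tau_F]<\infty$ for every density $\rho$ and every $i\in F$. Moreover $E_{i,\rho}[T_i]<\infty$ for every site $i\in V$ and every density $\rho$. -/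

import Mathlib

open MeasureTheory ProbabilityTheory
open scoped Matrix ENNReal ComplexOrder

/-- Density matrices of order `N`: positive semidefinite complex matrices of trace one. -/
def Density (N : ℕ) : Type :=
  {ρ : Matrix (Fin N) (Fin N) ℂ // ρ.PosSemidef ∧ ρ.trace = 1}

namespace Density

variable {N : ℕ}

/-- The topology inherited from the space of matrices. -/
instance : TopologicalSpace (Density N) :=
  inferInstanceAs (TopologicalSpace
    {ρ : Matrix (Fin N) (Fin N) ℂ // ρ.PosSemidef ∧ ρ.trace = 1})

/-- The Borel sigma-algebra. -/
instance : MeasurableSpace (Density N) := borel _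

instance : BorelSpace (Density N) := ⟨rfl⟩

/-- The underlying matrix of a density. -/
def mat (ρ : Density N) : Matrix (Fin N) (Fin N) ℂ := ρ.1

theorem posSemidef (ρ : Density N) : ρ.mat.PosSemidef := ρ.2.1

theorem trace_mat (ρ : Density N) : ρ.mat.trace = 1 := ρ.2.2

theorem continuous_mat : Continuous (mat : Density N → Matrix (Fin N) (Fin N) ℂ) :=
  continuous_subtype_val

theorem isInducing_mat :
    Topology.IsInducing (mat : Density N → Matrix (Fin N) (Fin N) ℂ) :=
  Topology.IsInducing.subtypeVal

end Density

/-- An open quantum walk with set of sites `V` and internal degree of freedom `ℂ^N`, given by its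
transition matrices: `B i j` describes the transition from site `i` to site `j`, and
`∑ j, (B i j)ᴴ * B i j = 1` for every site `i`. -/
structure OQW (V : Type*) (N : ℕ) where
  B : V → V → Matrix (Fin N) (Fin N) ℂ
  hasSum_one : ∀ i, HasSum (fun j => (B i j)ᴴ * B i j) 1

namespace OQW

variable {V : Type*} {N : ℕ}

/-- The unnormalised density `B i j ρ (B i j)ᴴ` after a transition from `i` to `j`. -/
def post (Φ : OQW V N) (ρ : Density N) (i j : V) : Matrix (Fin N) (Fin N) ℂ :=
  Φ.B i j * ρ.mat * (Φ.B i j)ᴴ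

/-- One-step transition probability from site `i` with density `ρ` to site `j`:
the (real, nonnegative) number `Tr (B i j ρ (B i j)ᴴ)`. -/
def prob (Φ : OQW V N) (ρ : Density N) (i j : V) : ℝ := (Φ.post ρ i j).trace.re

theorem post_posSemidef (Φ : OQW V N) (ρ : Density N) (i j : V) :
    (Φ.post ρ i j).PosSemidef :=
  ρ.posSemidef.mul_mul_conjTranspose_same _

theorem prob_nonneg (Φ : OQW V N) (ρ : Density N) (i j : V) : 0 ≤ Φ.prob ρ i j :=
  (Complex.le_def.1 (Φ.post_posSemidef ρ i j).trace_nonneg).1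

theorem trace_post (Φ : OQW V N) (ρ : Density N) (i j : V) :
    (Φ.post ρ i j).trace = (Φ.prob ρ i j : ℂ) := by
  have h := (Complex.le_def.1 (Φ.post_posSemidef ρ i j).trace_nonneg).2
  exact Complex.ext (by simp [prob]) (by simpa using h.symm)

theorem hasSum_prob (Φ : OQW V N) (ρ : Density N) (i : V) :
    HasSum (fun j => Φ.prob ρ i j) 1 := by
  have h1 : Continuous fun A : Matrix (Fin N) (Fin N) ℂ => (A * ρ.mat).trace.re := by fun_prop
  let f : Matrix (Fin N) (Fin N) ℂ →+ ℝ :=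
    { toFun := fun A => (A * ρ.mat).trace.re
      map_zero' := by simp
      map_add' := fun A A' => by simp [add_mul] }
  have h2 := (Φ.hasSum_one i).map f h1
  have h3 : f 1 = 1 := by simp [f, ρ.trace_mat]
  rw [h3] at h2
  convert h2 using 2 with j
  simp only [Function.comp_apply, prob, post, f, AddMonoidHom.coe_mk, ZeroHom.coe_mk]
  rw [Matrix.mul_assoc, Matrix.trace_mul_comm, Matrix.trace_mul_comm _ ρ.mat, Matrix.mul_assoc]

open Classical in
/-- The density after a transition from `i` to `j`, namely
`B i j ρ (B i j)ᴴ / Tr (B i j ρ (B i j)ᴴ)`. If the transition has probability zero, it never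
occurs and the value is irrelevant; `ρ` is kept. -/
noncomputable def next (Φ : OQW V N) (i j : V) (ρ : Density N) : Density N :=
  if h : Φ.prob ρ i j = 0 then ρ
  else ⟨((Φ.prob ρ i j : ℝ) : ℂ)⁻¹ • Φ.post ρ i j,
    (Φ.post_posSemidef ρ i j).smul (by
      rw [← Complex.ofReal_inv]
      exact_mod_cast inv_nonneg.2 (Φ.prob_nonneg ρ i j)),
    by
      rw [Matrix.trace_smul, trace_post, smul_eq_mul]
      exact inv_mul_cancel₀ (by exact_mod_cast h)⟩

theorem continuous_post (Φ : OQW V N) (i j : V) : Continuous fun ρ => Φ.post ρ i j := by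
  have := Density.continuous_mat (N := N)
  unfold post
  fun_prop

theorem continuous_prob (Φ : OQW V N) (i j : V) : Continuous fun ρ => Φ.prob ρ i j :=
  Complex.continuous_re.comp (Φ.continuous_post i j).matrix_trace

theorem mat_next (Φ : OQW V N) (i j : V) (ρ : Density N) (h : Φ.prob ρ i j ≠ 0) :
    (Φ.next i j ρ).mat = ((Φ.prob ρ i j : ℝ) : ℂ)⁻¹ • Φ.post ρ i j := by
  simp [next, h, Density.mat]

open Classical in
theorem measurable_next (Φ : OQW V N) (i j : V) : Measurable (Φ.next i j) := by
  have hs : IsClosed {ρ : Density N | Φ.prob ρ i j = 0} :=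
    isClosed_eq (Φ.continuous_prob i j) continuous_const
  have h : Φ.next i j = Set.piecewise {ρ : Density N | Φ.prob ρ i j = 0} id (Φ.next i j) := by
    funext ρ
    by_cases h : Φ.prob ρ i j = 0
    · simp [Set.piecewise, next, h]
    · simp only [Set.piecewise, Set.mem_ofPred_eq, h, if_false]
  rw [h]
  refine ContinuousOn.measurable_piecewise continuousOn_id ?_ hs.measurableSet
  rw [Density.isInducing_mat.continuousOn_iff]
  have hc : ContinuousOn (fun ρ => ((Φ.prob ρ i j : ℝ) : ℂ)⁻¹ • Φ.post ρ i j)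
      {ρ : Density N | Φ.prob ρ i j = 0}ᶜ := by
    have h1 : ContinuousOn (fun ρ => ((Φ.prob ρ i j : ℝ) : ℂ))
        {ρ : Density N | Φ.prob ρ i j = 0}ᶜ :=
      (Complex.continuous_ofReal.comp (Φ.continuous_prob i j)).continuousOn
    have h2 : ∀ ρ ∈ {ρ : Density N | Φ.prob ρ i j = 0}ᶜ, ((Φ.prob ρ i j : ℝ) : ℂ) ≠ 0 :=
      fun ρ hρ => by exact_mod_cast hρ
    exact (h1.inv₀ h2).smul (Φ.continuous_post i j).continuousOn
  exact hc.congr fun ρ hρ => Φ.mat_next i j ρ hρ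

section Walk

variable [Countable V] [MeasurableSpace V] [DiscreteMeasurableSpace V]

/-- Transition kernel of the quantum trajectories `(ρ_n, X_n)`: from `(ρ, i)` the walk jumps, with
probability `Tr (B i j ρ (B i j)ᴴ)`, to site `j`, with the normalised density `Φ.next i j ρ`. -/
noncomputable def step (Φ : OQW V N) : Kernel (Density N × V) (Density N × V) where
  toFun s := Measure.sum fun j =>
    ENNReal.ofReal (Φ.prob s.1 s.2 j) • Measure.dirac (Φ.next s.2 j s.1, j)
  measurable' := by
    refine Measure.measurable_of_measurable_coe _ fun S hS => ?_
    simp only [Measure.sum_apply _ hS, Measure.smul_apply, smul_eq_mul,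
      Measure.dirac_apply' _ hS]
    refine Measurable.tsum fun j => measurable_from_prod_countable_left fun i => ?_
    refine Measurable.mul ?_ ?_
    · exact (Φ.continuous_prob i j).measurable.ennreal_ofReal
    · exact (measurable_one.indicator hS).comp
        ((Φ.measurable_next i j).prodMk measurable_const)

instance (Φ : OQW V N) : IsMarkovKernel Φ.step where
  isProbabilityMeasure s := ⟨by
    change (Measure.sum fun j =>
      ENNReal.ofReal (Φ.prob s.1 s.2 j) • Measure.dirac (Φ.next s.2 j s.1, j)) Set.univ = 1
    simp only [Measure.sum_apply _ MeasurableSet.univ, Measure.smul_apply, measure_univ,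
      smul_eq_mul, mul_one]
    rw [← ENNReal.ofReal_tsum_of_nonneg (fun j => Φ.prob_nonneg s.1 s.2 j)
      (Φ.hasSum_prob s.1 s.2).summable, (Φ.hasSum_prob s.1 s.2).tsum_eq, ENNReal.ofReal_one]⟩

/-- The law of the trajectory `(ρ_n, X_n)`, `n ≥ 0`, started at site `i` with density `ρ`:
the law on sequences of the homogeneous Markov chain with transition kernel `Φ.step`. -/
noncomputable def law (Φ : OQW V N) (ρ : Density N) (i : V) : Measure (ℕ → Density N × V) :=
  Kernel.traj (X := fun _ => Density N × V)
    (fun n => Φ.step.comap (fun x : (Π _ : Finset.Iic n, Density N × V) =>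
      x ⟨n, Finset.mem_Iic.2 le_rfl⟩) (measurable_pi_apply _))
    0 (fun _ => (ρ, i))

end Walk

/-- The return time `inf {n ≥ 1 | X_n ∈ F}` to a set `F` of sites (`⊤` if there is no return). -/
noncomputable def returnTime (F : Set V) (ω : ℕ → Density N × V) : ℕ∞ :=
  ⨅ (n : ℕ) (_ : 1 ≤ n ∧ (ω n).2 ∈ F), (n : ℕ∞)

/-- The expected return time to `F`, starting at site `i` with density `ρ`. -/
noncomputable def expectedReturnTime [Countable V] [MeasurableSpace V] [DiscreteMeasurableSpace V]
    (Φ : OQW V N) (ρ : Density N) (i : V) (F : Set V) : ℝ≥0∞ :=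
  ∫⁻ ω, (returnTime F ω : ℝ≥0∞) ∂(Φ.law ρ i)

open Classical in
/-- The Kraus operator `B i j ⊗ |j⟩⟨i|` on the Hilbert space `ℓ²(V; ℂ^N) = ℂ^N ⊗ ℓ²(V)`. -/
noncomputable def kraus (Φ : OQW V N) (i j : V)
    (x : lp (fun _ : V => EuclideanSpace ℂ (Fin N)) 2) :
    lp (fun _ : V => EuclideanSpace ℂ (Fin N)) 2 :=
  lp.single 2 j (WithLp.toLp 2 (Φ.B i j *ᵥ (x i).ofLp))

/-- Irreducibility: the only closed subspaces of `ℓ²(V; ℂ^N)` that are invariant under all Kraus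
operators are the trivial ones. -/
def Irreducible (Φ : OQW V N) : Prop :=
  ∀ W : Submodule ℂ (lp (fun _ : V => EuclideanSpace ℂ (Fin N)) 2),
    IsClosed (W : Set (lp (fun _ : V => EuclideanSpace ℂ (Fin N)) 2)) →
    (∀ i j, ∀ x ∈ W, Φ.kraus i j x ∈ W) → W = ⊥ ∨ W = ⊤

end OQW

/-!
Let `A` be a set of states of a Markov chain with kernel `P`, and let `killed P A` be the
transition operator of the chain killed on entering `A`. The expected return time to `A` is the sum
of the survival probabilities `(killed P A)^n 1`. By iteration it is at most every function `v ≥ 0`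
with `1 + killed P A v ≤ v` (`MarkovChain.tsum_survival_le`). It is therefore enough to exhibit
finite functions of this kind; neither stopping times nor the strong Markov property are needed.

Put `g = (h - m) / ε`, where `m` is a lower bound of `h`. By assumption its drift off `F` is at most
`-1`. On `F` its one-step mean is bounded by a constant `C`, uniformly in the density: every density
`ρ` satisfies `ρ ≤ 1`, so its transition probabilities are at most `N` times those of the maximally
mixed density. For the return to `F`, take `v = g` off `F` and `v = g + 1 + C` on `F`
(`MarkovChain.tsum_survival_lt_top_of_drift`).

For the return to a site `i`, irreducibility enters. The vectors annihilated by the products of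
transition matrices along all paths of positive length to `i` form a closed invariant subspace. It
is not the whole space: otherwise no transition would lead to `i`, and the vectors vanishing at `i`
would form a proper nontrivial invariant subspace. So it is zero
(`OQW.Irreducible.exists_pathOp`). Hence for every site and density some path to `i` has positive
probability `Tr (M ρ Mᴴ)`. This depends continuously on `ρ`, and the densities form a compact space;
so there are `L` and `δ > 0` such that from every point over the finite set `F` the walk enters
`{i}` within `L` steps with probability at least `δ`
(`OQW.Irreducible.exists_survival_add_le_one`). The function `f = ∑ n < L, (killed P A)^n 1`
telescopes: `killed P A f = f - 1 + (killed P A)^L 1`. Its killed drift is nonpositive everywhere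
and at most `-δ` over `F`, so that `v = g + ((1 + C) / δ) f` is as required
(`MarkovChain.tsum_survival_lt_top`).
-/

/-! ### Return times of Markov chains -/

namespace MarkovChain

variable {S : Type*}

/-- The indicator function of the event that the path avoids `A` at all times `1, …, n`. -/
noncomputable def alive (A : Set S) (n : ℕ) (ω : ℕ → S) : ℝ≥0∞ :=
  ∏ k ∈ Finset.range n, Aᶜ.indicator 1 (ω (k + 1))

theorem alive_succ {A : Set S} (n : ℕ) (ω : ℕ → S) :
    alive A (n + 1) ω = alive A n ω * Aᶜ.indicator 1 (ω (n + 1)) :=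
  Finset.prod_range_succ _ _

theorem alive_eq_one_or_exists {A : Set S} (n : ℕ) (ω : ℕ → S) :
    alive A n ω = 1 ∨ ∃ k < n, ω (k + 1) ∈ A := by
  by_cases h : ∃ k < n, ω (k + 1) ∈ A
  · exact .inr h
  · push Not at h
    exact .inl (Finset.prod_eq_one fun k hk => by simp [h k (Finset.mem_range.1 hk)])

variable [MeasurableSpace S]

/-- The law on sequences of the homogeneous Markov chain with transition kernel `P` started
at `s`. -/
noncomputable def law (P : Kernel S S) [IsMarkovKernel P] (s : S) : Measure (ℕ → S) :=
  Kernel.traj (X := fun _ => S)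
    (fun n => P.comap (fun x : (Π _ : Finset.Iic n, S) => x ⟨n, Finset.mem_Iic.2 le_rfl⟩)
      (measurable_pi_apply _))
    0 (fun _ => s)

/-- The transition operator of the chain killed on entering `A`:
`(killed P A f) s = E_s[f (X₁); X₁ ∉ A]`. -/
noncomputable def killed (P : Kernel S S) (A : Set S) (f : S → ℝ≥0∞) (s : S) : ℝ≥0∞ :=
  ∫⁻ y, Aᶜ.indicator f y ∂P s

/-- The probability that the chain started at `s` avoids `A` at all times `1, …, n`. -/
noncomputable def survival (P : Kernel S S) (A : Set S) (n : ℕ) : S → ℝ≥0∞ :=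
  (killed P A)^[n] 1

variable {P : Kernel S S} {A : Set S}

theorem killed_mono {f g : S → ℝ≥0∞} (h : f ≤ g) : killed P A f ≤ killed P A g :=
  fun _ => lintegral_mono fun _ => Set.indicator_le_indicator (h _)

theorem killed_le (f : S → ℝ≥0∞) (s : S) : killed P A f s ≤ ∫⁻ y, f y ∂P s :=
  lintegral_mono (Set.indicator_le_self _ _)

theorem measurable_killed (hA : MeasurableSet A) {f : S → ℝ≥0∞} (hf : Measurable f) :
    Measurable (killed P A f) :=
  (hf.indicator hA.compl).lintegral_kernel

theorem killed_add (hA : MeasurableSet A) {f : S → ℝ≥0∞} (hf : Measurable f) (g : S → ℝ≥0∞) :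
    killed P A (f + g) = killed P A f + killed P A g := by
  funext s
  simp only [killed, Pi.add_apply, Set.indicator_add']
  exact lintegral_add_left (hf.indicator hA.compl) _

theorem killed_const_smul (hA : MeasurableSet A) {f : S → ℝ≥0∞} (hf : Measurable f) (c : ℝ≥0∞) :
    killed P A (c • f) = c • killed P A f := by
  funext s
  simp only [killed, Pi.smul_apply, smul_eq_mul]
  rw [← lintegral_const_mul _ (hf.indicator hA.compl)]
  refine lintegral_congr fun y => ?_
  by_cases h : y ∈ A <;> simp [h]

@[simp]
theorem survival_zero : survival P A 0 = 1 := rfl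

theorem survival_succ (n : ℕ) : survival P A (n + 1) = killed P A (survival P A n) :=
  Function.iterate_succ_apply' _ _ _

theorem measurable_survival (hA : MeasurableSet A) (n : ℕ) : Measurable (survival P A n) := by
  induction n with
  | zero => exact measurable_one
  | succ n ih => rw [survival_succ]; exact measurable_killed hA ih

theorem survival_succ_le [IsMarkovKernel P] (n : ℕ) : survival P A (n + 1) ≤ survival P A n := by
  induction n with
  | zero =>
    intro s
    rw [survival_succ]
    exact (killed_le _ s).trans (by simp)
  | succ n ih =>
    calc survival P A (n + 1 + 1) = killed P A (survival P A (n + 1)) := survival_succ _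
      _ ≤ killed P A (survival P A n) := killed_mono ih
      _ = survival P A (n + 1) := (survival_succ n).symm

theorem antitone_survival [IsMarkovKernel P] : Antitone (survival P A) :=
  antitone_nat_of_succ_le survival_succ_le

theorem survival_le_one [IsMarkovKernel P] (n : ℕ) (s : S) : survival P A n s ≤ 1 :=
  antitone_survival (Nat.zero_le n) s

theorem killed_sum_survival (hA : MeasurableSet A) (m : ℕ) :
    killed P A (∑ n ∈ Finset.range m, survival P A n)
      = ∑ n ∈ Finset.range m, survival P A (n + 1) := by
  induction m with
  | zero => funext s; simp [killed]
  | succ m ih =>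
    have hm : Measurable (∑ n ∈ Finset.range m, survival P A n) := by
      rw [Finset.sum_fn]
      exact Finset.measurable_sum _ fun n _ => measurable_survival hA n
    rw [Finset.sum_range_succ, Finset.sum_range_succ, killed_add hA hm, ih, survival_succ m]

/-- A function `v` with `1 + E[v (X₁); X₁ ∉ A] ≤ v` dominates the expected return time to `A`,
written here as the sum of the survival probabilities. -/
theorem tsum_survival_le (hA : MeasurableSet A) {v : S → ℝ≥0∞}
    (hv : ∀ s, 1 + killed P A v s ≤ v s) (s : S) : ∑' n, survival P A n s ≤ v s := by
  have key : ∀ m, ∑ n ∈ Finset.range m, survival P A n ≤ v := by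
    intro m
    induction m with
    | zero => intro s; simp
    | succ m ih =>
      intro s
      rw [Finset.sum_range_succ', ← killed_sum_survival hA, add_comm]
      exact (add_le_add_right (killed_mono ih s) 1).trans (hv s)
  refine ENNReal.tsum_le_of_sum_range_le fun m => ?_
  simpa using key m s

/-- Foster's criterion. If `g` has drift at most `-1` off `A` and the one-step mean of `g` is
bounded on `A`, then the expected return time to `A` is finite. -/
theorem tsum_survival_lt_top_of_drift (hA : MeasurableSet A) {g : S → ℝ≥0∞}
    (hg_fin : ∀ s, g s ≠ ⊤) {C : ℝ≥0∞} (hC : C ≠ ⊤)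
    (h_on : ∀ s ∈ A, ∫⁻ y, g y ∂P s ≤ C) (h_off : ∀ s ∉ A, 1 + ∫⁻ y, g y ∂P s ≤ g s) (s : S) :
    ∑' n, survival P A n s < ⊤ := by
  -- The values on `A` do not enter `killed P A v`, so `g` may be increased there.
  set v : S → ℝ≥0∞ := g + A.indicator (fun _ => 1 + C) with hv_def
  have hkill : ∀ t, killed P A v t ≤ ∫⁻ y, g y ∂P t := fun t => lintegral_mono fun y => by
    by_cases hy : y ∈ A <;> simp [hv_def, hy]
  have hv : ∀ t, 1 + killed P A v t ≤ v t := fun t => by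
    refine (add_le_add_right (hkill t) 1).trans ?_
    by_cases ht : t ∈ A
    · rw [hv_def, Pi.add_apply, Set.indicator_of_mem ht]
      exact (add_le_add_right (h_on t ht) 1).trans le_add_self
    · exact (h_off t ht).trans le_self_add
  refine (tsum_survival_le hA hv s).trans_lt ?_
  refine ENNReal.add_lt_top.2 ⟨(hg_fin s).lt_top, lt_of_le_of_lt (Set.indicator_le_self _ _ s) ?_⟩
  exact ENNReal.add_lt_top.2 ⟨ENNReal.one_lt_top, hC.lt_top⟩

/-- Foster's criterion with a target. If `g` has drift at most `-1` off `K` and the one-step mean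
of `g` is bounded on `K`, and if from each point of `K` the chain enters `A` within `L` steps with
probability at least `δ`, then the expected return time to `A` is finite. -/
theorem tsum_survival_lt_top [IsMarkovKernel P] (hA : MeasurableSet A) {K : Set S}
    {g : S → ℝ≥0∞} (hg : Measurable g) (hg_fin : ∀ s, g s ≠ ⊤) {C : ℝ≥0∞} (hC : C ≠ ⊤)
    (h_on : ∀ s ∈ K, ∫⁻ y, g y ∂P s ≤ C) (h_off : ∀ s ∉ K, 1 + ∫⁻ y, g y ∂P s ≤ g s)
    {L : ℕ} {δ : ℝ≥0∞} (hδ : δ ≠ 0) (hL : ∀ s ∈ K, survival P A L s + δ ≤ 1) (s : S) :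
    ∑' n, survival P A n s < ⊤ := by
  set f : S → ℝ≥0∞ := ∑ n ∈ Finset.range L, survival P A n with hf
  set a : ℝ≥0∞ := (1 + C) / δ with ha
  have ha_top : a ≠ ⊤ := ENNReal.div_ne_top (by simp [hC]) hδ
  have hf_meas : Measurable f := by
    rw [hf, Finset.sum_fn]
    exact Finset.measurable_sum _ fun n _ => measurable_survival hA n
  have hf_top : ∀ t, f t ≠ ⊤ := fun t => by
    rw [hf, Finset.sum_apply]
    exact ENNReal.sum_ne_top.2 fun n _ =>
      ne_top_of_le_ne_top ENNReal.one_ne_top (survival_le_one n t)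
  -- The sum telescopes: `killed P A f` is `f` with its first term replaced by the next one.
  have hf_eq : ∀ t, killed P A f t + 1 = f t + survival P A L t := fun t => by
    have h1 := Finset.sum_range_succ (fun n => survival P A n t) L
    rw [Finset.sum_range_succ'] at h1
    rw [hf, killed_sum_survival hA]
    simpa using h1
  have hf_le : ∀ t, killed P A f t ≤ f t := fun t => by
    refine (ENNReal.add_le_add_iff_right ENNReal.one_ne_top).1 ((hf_eq t).trans_le ?_)
    gcongr
    exact survival_le_one L t
  have hf_drift : ∀ t ∈ K, killed P A f t + δ ≤ f t := fun t ht => by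
    have hfin : survival P A L t ≠ ⊤ :=
      ne_top_of_le_ne_top ENNReal.one_ne_top (survival_le_one L t)
    refine (ENNReal.add_le_add_iff_right hfin).1 ?_
    rw [← hf_eq t, add_assoc, add_comm δ]
    gcongr
    exact hL t ht
  have hv : ∀ t, 1 + killed P A (g + a • f) t ≤ (g + a • f) t := fun t => by
    rw [killed_add hA hg, killed_const_smul hA hf_meas]
    simp only [Pi.add_apply, Pi.smul_apply, smul_eq_mul]
    by_cases ht : t ∈ K
    · have hδ_top : δ ≠ ⊤ :=
        ne_top_of_le_ne_top ENNReal.one_ne_top (le_add_self.trans (hL t ht))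
      calc 1 + (killed P A g t + a * killed P A f t)
          ≤ 1 + (C + a * killed P A f t) := by
            gcongr
            exact (killed_le g t).trans (h_on t ht)
        _ = a * (killed P A f t + δ) := by
            rw [mul_add, ENNReal.div_mul_cancel hδ hδ_top]
            ring
        _ ≤ a * f t := by gcongr; exact hf_drift t ht
        _ ≤ g t + a * f t := le_add_self
    · rw [← add_assoc]
      gcongr
      · exact (add_le_add_right (killed_le g t) 1).trans (h_off t ht)
      · exact hf_le t
  refine (tsum_survival_le hA hv s).trans_lt ?_
  simp only [Pi.add_apply, Pi.smul_apply, smul_eq_mul]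
  exact ENNReal.add_lt_top.2 ⟨(hg_fin s).lt_top, ENNReal.mul_lt_top ha_top.lt_top (hf_top s).lt_top⟩

theorem measurable_alive (hA : MeasurableSet A) (n : ℕ) : Measurable (alive A n) := by
  unfold alive
  exact Finset.measurable_prod _ fun k _ =>
    (measurable_one.indicator hA.compl).comp (measurable_pi_apply (k + 1))

/-- The Markov property, for functions of the last two positions of a killed path. -/
theorem lintegral_alive_mul_succ [IsMarkovKernel P] (hA : MeasurableSet A) {f : S → ℝ≥0∞}
    (hf : Measurable f) (n : ℕ) (s : S) :
    ∫⁻ ω, alive A n ω * f (ω (n + 1)) ∂law P s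
      = ∫⁻ ω, alive A n ω * ∫⁻ y, f y ∂P (ω n) ∂law P s := by
  set κ : (n : ℕ) → Kernel (Π _ : Finset.Iic n, S) S := fun n =>
    P.comap (fun x : (Π _ : Finset.Iic n, S) => x ⟨n, Finset.mem_Iic.2 le_rfl⟩)
      (measurable_pi_apply _) with hκ
  -- `alive A n` depends only on the path up to time `n`.
  set G : (Π _ : Finset.Iic n, S) → ℝ≥0∞ := fun x =>
    ∏ k : Fin n, Aᶜ.indicator 1 (x ⟨k + 1, Finset.mem_Iic.2 k.2⟩) with hG
  have hG_meas : Measurable G := by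
    exact Finset.measurable_prod _ fun k _ =>
      (measurable_one.indicator hA.compl).comp (measurable_pi_apply _)
  have hG_alive : ∀ ω : ℕ → S, alive A n ω = G (Preorder.frestrictLe n ω) := fun ω => by
    rw [alive, Finset.prod_range]
    rfl
  have h1 := Kernel.partialTraj_compProd_eq_map_traj (X := fun _ => S) (κ := κ) (Nat.zero_le n)
    (x₀ := fun _ => s)
  have h2 := Kernel.traj_map_frestrictLe_apply (X := fun _ => S) (κ := κ) 0 n (fun _ => s)
  have hmeas : Measurable fun z : (Π _ : Finset.Iic n, S) × S => G z.1 * f z.2 := by fun_prop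
  have h3 : ∫⁻ ω, alive A n ω * f (ω (n + 1)) ∂law P s
      = ∫⁻ z, G z.1 * f z.2
        ∂((Kernel.traj (X := fun _ => S) κ 0 (fun _ => s)).map
          (fun x => (Preorder.frestrictLe n x, x (n + 1)))) := by
    rw [lintegral_map hmeas (by fun_prop)]
    simp only [hG_alive]
    rfl
  rw [h3, ← h1, Measure.lintegral_compProd hmeas, ← h2,
    lintegral_map (hmeas.lintegral_kernel_prod_right') (by fun_prop)]
  refine lintegral_congr fun ω => ?_
  rw [hG_alive]
  exact lintegral_const_mul (μ := P (ω n)) (G (Preorder.frestrictLe n ω)) hf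

/-- The law of the killed chain at time `n` is given by the `n`-th iterate of its transition
operator. -/
theorem lintegral_alive_mul [IsMarkovKernel P] (hA : MeasurableSet A) (n : ℕ) (s : S) :
    ∀ {f : S → ℝ≥0∞}, Measurable f →
      ∫⁻ ω, alive A n ω * f (ω n) ∂law P s = (killed P A)^[n] f s := by
  induction n with
  | zero =>
    intro f hf
    -- At time zero the path is at its starting point `s`.
    have h2 := Kernel.traj_map_frestrictLe_apply (X := fun _ => S) (κ := fun n =>
      P.comap (fun x : (Π _ : Finset.Iic n, S) => x ⟨n, Finset.mem_Iic.2 le_rfl⟩)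
      (measurable_pi_apply _)) 0 0 (fun _ => s)
    rw [Kernel.partialTraj_self, Kernel.id_apply] at h2
    have hm : Measurable fun x : (Π _ : Finset.Iic 0, S) =>
        f (x ⟨0, Finset.mem_Iic.2 le_rfl⟩) := by fun_prop
    have h3 := lintegral_map (μ := law P s) hm (Preorder.measurable_frestrictLe (X := fun _ => S) 0)
    rw [law, h2, lintegral_dirac' _ hm] at h3
    simpa [alive, law] using h3.symm
  | succ n ih =>
    intro f hf
    rw [Function.iterate_succ_apply, ← ih (measurable_killed hA hf)]
    refine Eq.trans ?_ (lintegral_alive_mul_succ hA (hf.indicator hA.compl) n s)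
    refine lintegral_congr fun ω => ?_
    rw [alive_succ, mul_assoc]
    congr 1
    by_cases h : ω (n + 1) ∈ A <;> simp [h]

theorem lintegral_alive [IsMarkovKernel P] (hA : MeasurableSet A) (n : ℕ) (s : S) :
    ∫⁻ ω, alive A n ω ∂law P s = survival P A n s := by
  have h := lintegral_alive_mul (P := P) hA n s (f := 1) measurable_one
  simp only [Pi.one_apply, mul_one] at h
  exact h

end MarkovChain

/-! ### Density matrices -/

section Frobenius

open scoped Matrix.Norms.Frobenius

theorem Matrix.trace_conjTranspose_mul_self_eq_norm_sq {m n : Type*} [Fintype m] [Fintype n]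
    (C : Matrix m n ℂ) : (Cᴴ * C).trace = ((‖C‖ ^ 2 : ℝ) : ℂ) := by
  rw [Matrix.frobenius_norm_def, ← Real.sqrt_eq_rpow, Real.sq_sqrt (by positivity)]
  simp only [Matrix.trace, Matrix.mul_apply, Matrix.diag, Matrix.conjTranspose_apply,
    RCLike.star_def, Complex.conj_mul', Real.rpow_ofNat, Complex.ofReal_sum, Complex.ofReal_pow]
  rw [Finset.sum_comm]

namespace Density

variable {N : ℕ}

theorem exists_eq_conjTranspose_mul_self (ρ : Density N) :
    ∃ C : Matrix (Fin N) (Fin N) ℂ, ρ.mat = Cᴴ * C ∧ ‖C‖ = 1 := by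
  obtain ⟨C, hC⟩ : ∃ C : Matrix (Fin N) (Fin N) ℂ, ρ.mat = Cᴴ * C := by
    open scoped MatrixOrder in
    exact CStarAlgebra.nonneg_iff_eq_star_mul_self.1 ρ.posSemidef.nonneg
  refine ⟨C, hC, ?_⟩
  have h := ρ.trace_mat
  rw [hC, Matrix.trace_conjTranspose_mul_self_eq_norm_sq] at h
  have h' : ‖C‖ ^ 2 = 1 := by exact_mod_cast h
  exact (pow_eq_one_iff_of_nonneg (norm_nonneg C) two_ne_zero).1 h'

/-- The set of density matrices is the image of the Frobenius unit sphere under the map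
`C ↦ Cᴴ * C`, hence it is compact. -/
instance : CompactSpace (Density N) := by
  rw [← isCompact_univ_iff, isInducing_mat.isCompact_iff]
  have h : mat '' (Set.univ : Set (Density N)) = (fun C : Matrix (Fin N) (Fin N) ℂ => Cᴴ * C) ''
      Metric.sphere (0 : Matrix (Fin N) (Fin N) ℂ) 1 := by
    ext M
    simp only [Set.image_univ, Set.mem_range, Set.mem_image, mem_sphere_zero_iff_norm]
    constructor
    · rintro ⟨ρ, rfl⟩
      obtain ⟨C, h1, h2⟩ := ρ.exists_eq_conjTranspose_mul_self
      exact ⟨C, h2, h1.symm⟩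
    · rintro ⟨C, hC, rfl⟩
      refine ⟨⟨Cᴴ * C, Matrix.posSemidef_conjTranspose_mul_self C, ?_⟩, rfl⟩
      rw [Matrix.trace_conjTranspose_mul_self_eq_norm_sq, hC]
      simp
  rw [h]
  have : ProperSpace (Matrix (Fin N) (Fin N) ℂ) := FiniteDimensional.proper ℂ _
  exact (isCompact_sphere _ _).image (by fun_prop)

theorem trace_mul_mat_mul_eq_zero_iff (ρ : Density N) (M : Matrix (Fin N) (Fin N) ℂ) :
    (M * ρ.mat * Mᴴ).trace = 0 ↔ M * ρ.mat = 0 := by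
  obtain ⟨C, hC, -⟩ := ρ.exists_eq_conjTranspose_mul_self
  refine ⟨fun h => ?_, fun h => by simp [h]⟩
  have h1 : M * ρ.mat * Mᴴ = (C * Mᴴ)ᴴ * (C * Mᴴ) := by
    simp [hC, Matrix.mul_assoc]
  rw [h1, Matrix.trace_conjTranspose_mul_self_eq_zero_iff] at h
  have h2 : M * Cᴴ = 0 := by simpa using congrArg Matrix.conjTranspose h
  rw [hC, ← Matrix.mul_assoc, h2, Matrix.zero_mul]

theorem re_trace_mul_mat_mul_nonneg (ρ : Density N) (M : Matrix (Fin N) (Fin N) ℂ) :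
    0 ≤ (M * ρ.mat * Mᴴ).trace.re :=
  (Complex.le_def.1 (ρ.posSemidef.mul_mul_conjTranspose_same M).trace_nonneg).1

/-- This amounts to `ρ ≤ 1`. With `ρ = Cᴴ * C` and `‖C‖ = 1` it is the submultiplicativity of the
Frobenius norm. -/
theorem re_trace_mul_mat_mul_le (ρ : Density N) (M : Matrix (Fin N) (Fin N) ℂ) :
    (M * ρ.mat * Mᴴ).trace.re ≤ (M * Mᴴ).trace.re := by
  obtain ⟨C, hC, hC1⟩ := ρ.exists_eq_conjTranspose_mul_self
  have h1 : M * ρ.mat * Mᴴ = (C * Mᴴ)ᴴ * (C * Mᴴ) := by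
    simp [hC, Matrix.mul_assoc]
  have h2 : M * Mᴴ = (Mᴴ)ᴴ * Mᴴ := by simp
  rw [h1, h2, Matrix.trace_conjTranspose_mul_self_eq_norm_sq,
    Matrix.trace_conjTranspose_mul_self_eq_norm_sq, Complex.ofReal_re, Complex.ofReal_re]
  have h3 := Matrix.frobenius_norm_mul C Mᴴ
  rw [hC1, one_mul] at h3
  gcongr

theorem exists_mulVec_ne_zero (ρ : Density N) : ∃ x, ρ.mat *ᵥ x ≠ 0 := by
  by_contra! h
  have h0 : ρ.mat = 0 := Matrix.ext_of_mulVec_single fun i =>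
    (h _).trans (Matrix.zero_mulVec _).symm
  simpa [h0] using ρ.trace_mat

theorem pos_of_density (ρ : Density N) : 0 < N := by
  obtain rfl | h := Nat.eq_zero_or_pos N
  · simpa [Matrix.trace] using ρ.trace_mat
  · exact h

/-- The maximally mixed state `N⁻¹ • 1`. -/
noncomputable def maximallyMixed (hN : 0 < N) : Density N :=
  ⟨(N : ℂ)⁻¹ • 1, Matrix.PosSemidef.one.smul (by positivity), by
    have : (N : ℂ) ≠ 0 := by exact_mod_cast hN.ne'
    simp [this]⟩

theorem mat_maximallyMixed (hN : 0 < N) : (maximallyMixed hN).mat = (N : ℂ)⁻¹ • 1 := rfl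

end Density

end Frobenius

namespace OQW

variable {V : Type*} {N : ℕ}

theorem prob_le_maximallyMixed (Φ : OQW V N) (hN : 0 < N) (ρ : Density N) (i j : V) :
    Φ.prob ρ i j ≤ N * Φ.prob (Density.maximallyMixed hN) i j := by
  have hN' : (N : ℝ) ≠ 0 := by exact_mod_cast hN.ne'
  have h : Φ.prob (Density.maximallyMixed hN) i j
      = (N : ℝ)⁻¹ * (Φ.B i j * (Φ.B i j)ᴴ).trace.re := by
    rw [prob, post, Density.mat_maximallyMixed, Matrix.mul_smul, Matrix.smul_mul, Matrix.mul_one,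
      Matrix.trace_smul, smul_eq_mul, ← Complex.ofReal_natCast, ← Complex.ofReal_inv,
      Complex.re_ofReal_mul]
  rw [h, mul_inv_cancel_left₀ hN']
  exact ρ.re_trace_mul_mat_mul_le _

end OQW

namespace OQW

variable {V : Type*} {N : ℕ}

theorem post_eq_zero (Φ : OQW V N) {ρ : Density N} {i j : V} (h : Φ.prob ρ i j = 0) :
    Φ.post ρ i j = 0 := by
  rw [← (Φ.post_posSemidef ρ i j).trace_eq_zero_iff, trace_post, h, Complex.ofReal_zero]

theorem tsum_ofReal_prob (Φ : OQW V N) (ρ : Density N) (i : V) :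
    ∑' j, ENNReal.ofReal (Φ.prob ρ i j) = 1 := by
  rw [← ENNReal.ofReal_tsum_of_nonneg (Φ.prob_nonneg ρ i) (Φ.hasSum_prob ρ i).summable,
    (Φ.hasSum_prob ρ i).tsum_eq, ENNReal.ofReal_one]

/-! ### Irreducibility and paths -/

/-- `Φ.PathOp i n k M` says that `M` is the product of the transition matrices along some path
of `n ≥ 1` steps from `k` to `i`. -/
inductive PathOp (Φ : OQW V N) (i : V) : ℕ → V → Matrix (Fin N) (Fin N) ℂ → Prop
  | single (k : V) : PathOp Φ i 1 k (Φ.B k i)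
  | cons (k j : V) {n : ℕ} {M : Matrix (Fin N) (Fin N) ℂ} :
      PathOp Φ i n j M → PathOp Φ i (n + 1) k (M * Φ.B k j)

theorem exists_B_ne_zero (Φ : OQW V N) (hN : 0 < N) (i : V) : ∃ j, Φ.B i j ≠ 0 := by
  have : NeZero N := ⟨hN.ne'⟩
  by_contra! h
  have h1 := Φ.hasSum_one i
  simp only [h, Matrix.mul_zero] at h1
  exact one_ne_zero (h1.unique hasSum_zero)

open Classical in
/-- The conditions `M *ᵥ x j = 0`, for `j` a site and `M` in a set `𝒞 j` of matrices, define a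
closed subspace, which is invariant if the Kraus operators preserve the conditions. If the walk is
irreducible, then either no nonzero vector located at one site fulfils them, or all vectors do. -/
theorem Irreducible.eq_zero_or_forall {Φ : OQW V N} (hΦ : Φ.Irreducible)
    (𝒞 : V → Set (Matrix (Fin N) (Fin N) ℂ))
    (h𝒞 : ∀ k j, ∀ M ∈ 𝒞 j, ∀ x : Fin N → ℂ, (∀ M' ∈ 𝒞 k, M' *ᵥ x = 0) →
      M *ᵥ (Φ.B k j *ᵥ x) = 0) :
    (∀ k, ∀ x : Fin N → ℂ, (∀ M ∈ 𝒞 k, M *ᵥ x = 0) → x = 0) ∨ ∀ k, ∀ M ∈ 𝒞 k, M = 0 := by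
  let W : Submodule ℂ (lp (fun _ : V => EuclideanSpace ℂ (Fin N)) 2) :=
    { carrier := {x | ∀ j, ∀ M ∈ 𝒞 j, M *ᵥ (x j).ofLp = 0}
      zero_mem' := fun j M _ => by simp
      add_mem' := fun {x y} hx hy j M hM => by
        simp [Matrix.mulVec_add, hx j M hM, hy j M hM]
      smul_mem' := fun c x hx j M hM => by
        simp [Matrix.mulVec_smul, hx j M hM] }
  have hW_closed : IsClosed (W : Set (lp (fun _ : V => EuclideanSpace ℂ (Fin N)) 2)) := by
    have h : (W : Set (lp (fun _ : V => EuclideanSpace ℂ (Fin N)) 2))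
        = ⋂ j, ⋂ M ∈ 𝒞 j, {x | M *ᵥ (x j).ofLp = 0} := by
      ext x
      simp [W]
    rw [h]
    refine isClosed_iInter fun j => isClosed_iInter fun M => isClosed_iInter fun _ => ?_
    refine isClosed_eq ?_ continuous_const
    have h1 : Continuous fun x : lp (fun _ : V => EuclideanSpace ℂ (Fin N)) 2 => x j :=
      (lp.lipschitzWith_one_eval 2 j).continuous
    have h2 : Continuous fun y : EuclideanSpace ℂ (Fin N) => M *ᵥ y.ofLp := by fun_prop
    exact h2.comp h1
  have hW_single : ∀ k (x : Fin N → ℂ), (∀ M ∈ 𝒞 k, M *ᵥ x = 0) →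
      lp.single 2 k (WithLp.toLp 2 x) ∈ W := fun k x hx j M hM => by
    by_cases hj : j = k
    · subst hj
      simpa using hx M hM
    · simp [hj]
  have hW_inv : ∀ i j, ∀ x ∈ W, Φ.kraus i j x ∈ W := fun i j x hx =>
    hW_single j _ fun M hM => h𝒞 i j M hM _ (hx i)
  refine (hΦ W hW_closed hW_inv).imp (fun h k x hx => ?_) fun h k M hM => ?_
  · have h1 := hW_single k x hx
    rw [h, Submodule.mem_bot] at h1
    have h2 := congrArg (fun y : lp (fun _ : V => EuclideanSpace ℂ (Fin N)) 2 => (y k).ofLp) h1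
    simpa using h2
  · refine Matrix.ext_of_mulVec_single fun a => ?_
    have h1 : lp.single 2 k (WithLp.toLp 2 (Pi.single a 1)) ∈ W := h ▸ Submodule.mem_top
    have h2 := h1 k M hM
    rw [Matrix.zero_mulVec]
    simpa using h2

theorem Irreducible.exists_B_ne_zero {Φ : OQW V N} (hΦ : Φ.Irreducible) (hN : 0 < N) (i : V) :
    ∃ k, Φ.B k i ≠ 0 := by
  classical
  have : NeZero N := ⟨hN.ne'⟩
  by_contra! h
  -- If no transition leads to `i`, then the vectors vanishing at `i` form an invariant subspace.
  rcases hΦ.eq_zero_or_forall (fun j => {M | j = i ∧ M = 1}) (fun k j M hM x _ => by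
    obtain ⟨rfl, -⟩ := hM
    simp [h]) with h1 | h1
  · obtain ⟨j, hj⟩ := Φ.exists_B_ne_zero hN i
    have hji : j ≠ i := fun e => hj (e ▸ h i)
    exact one_ne_zero (congrFun (h1 j 1 fun M hM => absurd hM.1 hji) (0 : Fin N))
  · exact one_ne_zero (h1 i 1 ⟨rfl, rfl⟩)

/-- In an irreducible walk no nonzero vector, wherever it is located, is annihilated by all
products of transition matrices along paths of positive length to a given site. -/
theorem Irreducible.exists_pathOp {Φ : OQW V N} (hΦ : Φ.Irreducible) (hN : 0 < N) (i k : V)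
    {x : Fin N → ℂ} (hx : x ≠ 0) : ∃ n M, Φ.PathOp i n k M ∧ M *ᵥ x ≠ 0 := by
  rcases hΦ.eq_zero_or_forall (fun j => {M | ∃ n, Φ.PathOp i n j M}) (fun k j M hM x h => by
    obtain ⟨n, hM⟩ := hM
    rw [Matrix.mulVec_mulVec]
    exact h _ ⟨n + 1, .cons k j hM⟩) with h | h
  · by_contra! h'
    exact hx (h k x fun M ⟨n, hM⟩ => h' n M hM)
  · obtain ⟨j, hj⟩ := hΦ.exists_B_ne_zero hN i
    exact absurd (h j _ ⟨1, .single j⟩) hj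

/-! ### Return times of quantum trajectories -/

theorem returnTime_le_tsum_alive (F : Set V) (ω : ℕ → Density N × V) :
    (returnTime F ω : ℝ≥0∞) ≤ ∑' n, MarkovChain.alive (Prod.snd ⁻¹' F) n ω := by
  classical
  by_cases h : ∀ n, MarkovChain.alive (Prod.snd ⁻¹' F) n ω = 1
  · simp [h]
  · push Not at h
    -- The path survives up to the first time at which `alive` is not one, and returns before it.
    obtain ⟨m, hm_spec, hm_min⟩ : ∃ m, MarkovChain.alive (Prod.snd ⁻¹' F) m ω ≠ 1 ∧
        ∀ n < m, MarkovChain.alive (Prod.snd ⁻¹' F) n ω = 1 :=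
      ⟨Nat.find h, Nat.find_spec h, fun n hn => not_not.1 (Nat.find_min h hn)⟩
    obtain ⟨k, hk, hkF⟩ := (MarkovChain.alive_eq_one_or_exists m ω).resolve_left hm_spec
    have h1 : returnTime F ω ≤ (m : ℕ∞) :=
      (iInf₂_le (k + 1) ⟨Nat.le_add_left 1 k, hkF⟩).trans (by exact_mod_cast hk)
    calc (returnTime F ω : ℝ≥0∞) ≤ ((m : ℕ∞) : ℝ≥0∞) := ENat.toENNReal_mono h1
      _ = ∑ n ∈ Finset.range m, MarkovChain.alive (Prod.snd ⁻¹' F) n ω := by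
        rw [Finset.sum_congr rfl fun n hn =>
          hm_min n (Finset.mem_range.1 hn)]
        simp
      _ ≤ _ := ENNReal.sum_le_tsum _

section Walk

variable [Countable V] [MeasurableSpace V] [DiscreteMeasurableSpace V]

theorem lintegral_step (Φ : OQW V N) {f : Density N × V → ℝ≥0∞} (hf : Measurable f)
    (ρ : Density N) (i : V) :
    ∫⁻ y, f y ∂Φ.step (ρ, i)
      = ∑' j, ENNReal.ofReal (Φ.prob ρ i j) * f (Φ.next i j ρ, j) := by
  change ∫⁻ y, f y ∂(Measure.sum fun j =>
      ENNReal.ofReal (Φ.prob ρ i j) • Measure.dirac (Φ.next i j ρ, j)) = _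
  rw [lintegral_sum_measure]
  refine tsum_congr fun j => ?_
  rw [lintegral_smul_measure, lintegral_dirac' _ hf, smul_eq_mul]

/-- The expected return time is bounded by the sum of the survival probabilities. -/
theorem expectedReturnTime_le (Φ : OQW V N) (ρ : Density N) (i : V) (F : Set V) :
    Φ.expectedReturnTime ρ i F
      ≤ ∑' n, MarkovChain.survival Φ.step (Prod.snd ⁻¹' F) n (ρ, i) := by
  have hF : MeasurableSet (Prod.snd ⁻¹' F : Set (Density N × V)) :=
    measurable_snd (MeasurableSet.of_discrete)
  calc Φ.expectedReturnTime ρ i F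
      ≤ ∫⁻ ω, ∑' n, MarkovChain.alive (Prod.snd ⁻¹' F) n ω ∂MarkovChain.law Φ.step (ρ, i) :=
        lintegral_mono fun ω => returnTime_le_tsum_alive F ω
    _ = _ := by
        rw [lintegral_tsum fun n => (MarkovChain.measurable_alive hF n).aemeasurable]
        exact tsum_congr fun n => MarkovChain.lintegral_alive hF n _

/-- If a function bounded by one misses one by `c` at the endpoint of a transition, then its
one-step mean misses one by the transition probability times `c`. -/
theorem lintegral_step_add_le_one (Φ : OQW V N) {f : Density N × V → ℝ≥0∞} (hf : Measurable f)
    (hf1 : ∀ s, f s ≤ 1) (ρ : Density N) (i j : V) {c : ℝ≥0∞} (hc : f (Φ.next i j ρ, j) + c ≤ 1) :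
    ∫⁻ y, f y ∂Φ.step (ρ, i) + ENNReal.ofReal (Φ.prob ρ i j) * c ≤ 1 := by
  classical
  rw [lintegral_step Φ hf, ← tsum_ite_eq j fun l => ENNReal.ofReal (Φ.prob ρ i l) * c,
    ← ENNReal.tsum_add, ← Φ.tsum_ofReal_prob ρ i]
  refine ENNReal.tsum_le_tsum fun l => ?_
  by_cases hl : l = j
  · subst hl
    rw [if_pos rfl, ← mul_add]
    exact mul_le_of_le_one_right' hc
  · rw [if_neg hl, add_zero]
    exact mul_le_of_le_one_right' (hf1 _)

/-- The probability of following a path with operator `M` is `Tr (M ρ Mᴴ)`, so that survival and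
this event are together at most one. -/
theorem PathOp.survival_add_le_one {Φ : OQW V N} {i k : V} {n : ℕ}
    {M : Matrix (Fin N) (Fin N) ℂ} (hM : Φ.PathOp i n k M) (ρ : Density N) :
    MarkovChain.survival Φ.step (Prod.snd ⁻¹' {i}) n (ρ, k)
      + ENNReal.ofReal (M * ρ.mat * Mᴴ).trace.re ≤ 1 := by
  have hF : MeasurableSet (Prod.snd ⁻¹' {i} : Set (Density N × V)) :=
    measurable_snd (MeasurableSet.of_discrete)
  have hle : ∀ (n : ℕ) (s : Density N × V), (Prod.snd ⁻¹' {i})ᶜ.indicator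
      (MarkovChain.survival Φ.step (Prod.snd ⁻¹' {i}) n) s ≤ 1 := fun n s =>
    (Set.indicator_le_self _ _ s).trans (MarkovChain.survival_le_one n s)
  have hmeas : ∀ n : ℕ, Measurable ((Prod.snd ⁻¹' {i})ᶜ.indicator
      (MarkovChain.survival Φ.step (Prod.snd ⁻¹' {i}) n)) := fun n =>
    (MarkovChain.measurable_survival hF n).indicator hF.compl
  induction hM generalizing ρ with
  | single k =>
    have h := Φ.lintegral_step_add_le_one (hmeas 0) (hle 0) ρ k i (c := 1) (by simp)
    rw [mul_one] at h
    exact h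
  | @cons k j n M hM ih =>
    have h := Φ.lintegral_step_add_le_one (hmeas n) (hle n) ρ k j
      (c := ENNReal.ofReal (M * (Φ.next k j ρ).mat * Mᴴ).trace.re)
      ((add_le_add_left (Set.indicator_le_self _ _ _) _).trans (ih _))
    rw [← ENNReal.ofReal_mul (Φ.prob_nonneg ρ k j)] at h
    have h1 : M * Φ.B k j * ρ.mat * (M * Φ.B k j)ᴴ = M * Φ.post ρ k j * Mᴴ := by
      simp only [post, Matrix.conjTranspose_mul, Matrix.mul_assoc]
    have h2 : Φ.prob ρ k j * (M * (Φ.next k j ρ).mat * Mᴴ).trace.re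
        = (M * Φ.post ρ k j * Mᴴ).trace.re := by
      by_cases hp : Φ.prob ρ k j = 0
      · simp [hp, Φ.post_eq_zero hp]
      · rw [Φ.mat_next k j ρ hp, Matrix.mul_smul, Matrix.smul_mul, Matrix.trace_smul,
          smul_eq_mul, ← Complex.ofReal_inv, Complex.re_ofReal_mul, mul_inv_cancel_left₀ hp]
    rw [h1, ← h2, MarkovChain.survival_succ]
    exact h

/-- From a given site, an irreducible walk reaches `i` within a bounded number of steps with a
probability bounded below uniformly in the initial density, because the densities form a compact
space. -/
theorem Irreducible.exists_survival_add_le_one_of_site {Φ : OQW V N} (hΦ : Φ.Irreducible)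
    (i k : V) : ∃ (L : ℕ) (δ : ℝ≥0∞), δ ≠ 0 ∧ ∀ ρ : Density N,
      MarkovChain.survival Φ.step (Prod.snd ⁻¹' {i}) L (ρ, k) + δ ≤ 1 := by
  suffices h : ∃ (L : ℕ) (δ : ℝ≥0∞), δ ≠ 0 ∧ ∀ ρ ∈ (Set.univ : Set (Density N)),
      MarkovChain.survival Φ.step (Prod.snd ⁻¹' {i}) L (ρ, k) + δ ≤ 1 by simpa using h
  refine isCompact_univ.induction_on (p := fun s => ∃ (L : ℕ) (δ : ℝ≥0∞), δ ≠ 0 ∧ ∀ ρ ∈ s,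
    MarkovChain.survival Φ.step (Prod.snd ⁻¹' {i}) L (ρ, k) + δ ≤ 1) ?_ ?_ ?_ ?_
  · exact ⟨0, 1, one_ne_zero, by simp⟩
  · rintro s t hst ⟨L, δ, hδ, h⟩
    exact ⟨L, δ, hδ, fun ρ hρ => h ρ (hst hρ)⟩
  · rintro s t ⟨L, δ, hδ, h⟩ ⟨L', δ', hδ', h'⟩
    refine ⟨max L L', min δ δ', (lt_min hδ.bot_lt hδ'.bot_lt).ne', fun ρ hρ => ?_⟩
    rcases hρ with hρ | hρ
    · refine le_trans ?_ (h ρ hρ)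
      exact add_le_add (MarkovChain.antitone_survival (le_max_left _ _) _) (min_le_left _ _)
    · refine le_trans ?_ (h' ρ hρ)
      exact add_le_add (MarkovChain.antitone_survival (le_max_right _ _) _) (min_le_right _ _)
  · intro ρ₀ _
    obtain ⟨x, hx⟩ := ρ₀.exists_mulVec_ne_zero
    obtain ⟨n, M, hM, hMx⟩ := hΦ.exists_pathOp ρ₀.pos_of_density i k hx
    have hpos : 0 < (M * ρ₀.mat * Mᴴ).trace.re := by
      refine (ρ₀.re_trace_mul_mat_mul_nonneg M).lt_of_ne' fun h0 => hMx ?_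
      have him := (Complex.le_def.1
        (ρ₀.posSemidef.mul_mul_conjTranspose_same M).trace_nonneg).2
      rw [Matrix.mulVec_mulVec,
        (ρ₀.trace_mul_mat_mul_eq_zero_iff M).1 (Complex.ext h0 him.symm), Matrix.zero_mulVec]
    have hcont : Continuous fun ρ : Density N => (M * ρ.mat * Mᴴ).trace.re := by
      have := Density.continuous_mat (N := N)
      fun_prop
    obtain ⟨c, hc0, hc⟩ := exists_between hpos
    refine ⟨_, mem_nhdsWithin_of_mem_nhds (hcont.continuousAt.eventually_const_lt hc), n,
      ENNReal.ofReal c, (ENNReal.ofReal_pos.2 hc0).ne', fun ρ hρ => ?_⟩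
    refine (add_le_add_right (ENNReal.ofReal_le_ofReal ?_) _).trans (hM.survival_add_le_one ρ)
    exact le_of_lt hρ

theorem Irreducible.exists_survival_add_le_one {Φ : OQW V N} (hΦ : Φ.Irreducible)
    (i : V) (F : Finset V) : ∃ (L : ℕ) (δ : ℝ≥0∞), δ ≠ 0 ∧ ∀ s : Density N × V, s.2 ∈ F →
      MarkovChain.survival Φ.step (Prod.snd ⁻¹' {i}) L s + δ ≤ 1 := by
  choose L δ hδ h using hΦ.exists_survival_add_le_one_of_site i
  refine ⟨F.sup L, F.inf δ, ?_, fun s hs => ?_⟩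
  · exact ((Finset.lt_inf_iff (by simp)).2 fun k _ => (hδ k).bot_lt).ne'
  · exact (add_le_add (MarkovChain.antitone_survival (Finset.le_sup hs) _)
      (Finset.inf_le hs)).trans (h s.2 s.1)

end Walk

end OQW

/-! ### Foster's theorem -/

theorem mainTheorem4 {V : Type*} [Countable V] [MeasurableSpace V] [DiscreteMeasurableSpace V]
    {N : ℕ} (Φ : OQW V N) (hΦ : Φ.Irreducible)
    (h : V → ℝ) (F : Finset V) (ε : ℝ) (hε : 0 < ε)
    (h_bdd : BddBelow (Set.range h))
    (h_fin : ∀ ρ : Density N, ∀ i ∈ F, Summable fun k => Φ.prob ρ i k * h k)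
    (h_drift : ∀ ρ : Density N, ∀ i ∉ F,
      (Summable fun k => Φ.prob ρ i k * h k) ∧ ∑' k, Φ.prob ρ i k * h k ≤ h i - ε) :
    (∀ ρ : Density N, ∀ i ∈ F, Φ.expectedReturnTime ρ i F < ⊤) ∧
      ∀ (ρ : Density N) (i : V), Φ.expectedReturnTime ρ i {i} < ⊤ := by
  obtain ⟨m, hm⟩ := h_bdd
  have hm : ∀ k, m ≤ h k := fun k => hm ⟨k, rfl⟩
  -- Normalise `h` to be nonnegative, with drift at most `-1` off `F`.
  set g : Density N × V → ℝ≥0∞ := fun s => ENNReal.ofReal ((h s.2 - m) / ε) with hg_def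
  have hg : Measurable g :=
    (Measurable.of_discrete (f := fun k : V => ENNReal.ofReal ((h k - m) / ε))).comp measurable_snd
  have hg_step : ∀ (ρ : Density N) (i : V), (Summable fun k => Φ.prob ρ i k * h k) →
      m ≤ ∑' k, Φ.prob ρ i k * h k ∧
      ∫⁻ y, g y ∂Φ.step (ρ, i) = ENNReal.ofReal ((∑' k, Φ.prob ρ i k * h k - m) / ε) := by
    intro ρ i hs
    have h1 : HasSum (fun k => Φ.prob ρ i k * (h k - m)) (∑' k, Φ.prob ρ i k * h k - m) := by
      simpa [mul_sub] using hs.hasSum.sub ((Φ.hasSum_prob ρ i).mul_right m)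
    have h0 : ∀ k, 0 ≤ Φ.prob ρ i k * (h k - m) := fun k =>
      mul_nonneg (Φ.prob_nonneg ρ i k) (sub_nonneg.2 (hm k))
    refine ⟨sub_nonneg.1 (h1.nonneg h0), ?_⟩
    have h2 := h1.div_const ε
    rw [Φ.lintegral_step hg, ← h2.tsum_eq,
      ENNReal.ofReal_tsum_of_nonneg (fun k => div_nonneg (h0 k) hε.le) h2.summable]
    refine tsum_congr fun k => ?_
    rw [hg_def, ← ENNReal.ofReal_mul (Φ.prob_nonneg ρ i k), mul_div_assoc]
  have hg_off : ∀ s : Density N × V, s ∉ (Prod.snd ⁻¹' F : Set (Density N × V)) →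
      1 + ∫⁻ y, g y ∂Φ.step s ≤ g s := by
    rintro ⟨ρ, i⟩ hi
    obtain ⟨hs, hle⟩ := h_drift ρ i hi
    obtain ⟨h1, h2⟩ := hg_step ρ i hs
    rw [h2, ← ENNReal.ofReal_one, ← ENNReal.ofReal_add zero_le_one
      (div_nonneg (sub_nonneg.2 h1) hε.le)]
    refine ENNReal.ofReal_le_ofReal ?_
    rw [le_div_iff₀ hε, add_mul, div_mul_cancel₀ _ hε.ne']
    linarith
  have hg_fin : ∀ s, g s ≠ ⊤ := fun s => ENNReal.ofReal_ne_top
  -- Every density is at most `N` times the maximally mixed one, which bounds the one-step mean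
  -- of `g` on `F` uniformly in the density.
  have hg_on : ∃ C : ℝ≥0∞, C ≠ ⊤ ∧ ∀ s ∈ (Prod.snd ⁻¹' F : Set (Density N × V)),
      ∫⁻ y, g y ∂Φ.step s ≤ C := by
    obtain hN | hN := Nat.eq_zero_or_pos N
    · exact ⟨0, ENNReal.zero_ne_top, fun s => absurd s.1.pos_of_density hN.not_gt⟩
    refine ⟨∑ i ∈ F, N * ∫⁻ y, g y ∂Φ.step (Density.maximallyMixed hN, i),
      ENNReal.sum_ne_top.2 fun i hi => ?_, ?_⟩
    · rw [(hg_step _ i (h_fin _ i hi)).2]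
      exact ENNReal.mul_ne_top (ENNReal.natCast_ne_top N) ENNReal.ofReal_ne_top
    · rintro ⟨ρ, i⟩ hi
      refine le_trans ?_ (Finset.single_le_sum (f := fun i =>
        N * ∫⁻ y, g y ∂Φ.step (Density.maximallyMixed hN, i)) (fun _ _ => zero_le) hi)
      rw [Φ.lintegral_step hg, Φ.lintegral_step hg, ← ENNReal.tsum_mul_left]
      refine ENNReal.tsum_le_tsum fun j => ?_
      rw [← mul_assoc, ← ENNReal.ofReal_natCast, ← ENNReal.ofReal_mul (Nat.cast_nonneg N)]
      exact mul_le_mul_left (ENNReal.ofReal_le_ofReal (Φ.prob_le_maximallyMixed hN ρ i j)) _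
  obtain ⟨C, hC, hg_on⟩ := hg_on
  refine ⟨fun ρ i _ => ?_, fun ρ i => ?_⟩
  · refine (Φ.expectedReturnTime_le ρ i F).trans_lt ?_
    exact MarkovChain.tsum_survival_lt_top_of_drift (measurable_snd (MeasurableSet.of_discrete))
      hg_fin hC hg_on hg_off (ρ, i)
  · refine (Φ.expectedReturnTime_le ρ i {i}).trans_lt ?_
    obtain ⟨L, δ, hδ, hL⟩ := hΦ.exists_survival_add_le_one i F
    exact MarkovChain.tsum_survival_lt_top (measurable_snd (MeasurableSet.of_discrete)) hg
      hg_fin hC hg_on hg_off hδ hL (ρ, i)
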